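/- Let $n$ be a natural number. An $n$-expression is a finite word on the letters $s_1,\dots,s_{n-1}$; an extended $n$-expression may also use letters of a formal copy $\bar s_1,\dots,\bar s_{n-1}$. For an $n$-expression $u=s_{i_1}\cdots s_{i_\ell}$, put $\bar u=\bar s_{i_\ell}\cdots\bar s_{i_1}$. The braid relations are (I) $s_is_js_i=s_js_is_j$ for $|i-j|=1$, and (II) $s_is_j=s_js_i$ for $|i-j|\ge 2$. The combinatorial distance $\mathrm{dist}(w,w')\in\mathbb{N}\cup\{\infty\}$ of two $n$-expressions is the minimal number of applications of braid relations that transform $w$ into $w'$ (and $\infty$ if there is no such transformation). Let $u,v$ be $n$-expressions. A compacted reversing diagram for $(u,v)$ is built as follows. Letters $s_i$ are drawn as horizontal right-oriented edges, letters $\bar s_i$ as vertical down-oriented edges, so that an extended expression describes a path from the bottom-left to the top-right. One starts with the path $\bar u\,v$, and one repeatedly glues a tile below and to the right of the current path, which replaces a factor $p$ of the current path (the left and top edges of the tile) by a word $q$ (its bottom and right edges), where $p\to q$ is one of - type I: $\bar s_i s_j\to s_js_i\bar s_j\bar s_i$ with $|i-j|=1$; - type I$'$: $\bar s_i s_js_i\to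 s_js_i\bar s_j$ with $|i-j|=1$; - type I$''$: $\bar s_j\bar s_i s_j\to s_i\bar s_j\bar s_i$ with $|i-j|=1$; - type II: $\bar s_i s_j\to s_j\bar s_i$ with $|i-j|\ge 2$; - type III (digon): $\bar s_is_i\to\varepsilon$, the empty word; until the path has the form $v'\,\bar{u'}$ for some $n$-expressions $u',v'$. The diagram then has the two boundary words $uv'$ (left and bottom sides) and $vu'$ (top and right sides). Claim: let $u,v$ be arbitrary $n$-expressions (in particular, reduced ones), and let $\mathcal D$ be a compacted reversing diagram for $(u,v)$ that contains no digon, i.e., that contains only tiles of types I, I$'$, I$''$ and II. Then $\mathcal D$ is optimal: the number of tiles of $\mathcal D$ is equal to $\mathrm{dist}(uv',vu')$ (in particular, this distance is finite). -/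

import Mathlib

/-- An `n`-expression: a word on the letters `s_1, …, s_{n-1}`
(the element `i : Fin (n - 1)` stands for the transposition `s_{i+1}`). -/
abbrev NExpr (n : ℕ) : Type := List (Fin (n - 1))

/-- The condition `|i - j| = 1`. -/
def Adjacent {n : ℕ} (i j : Fin (n - 1)) : Prop := |((i : ℕ) : ℤ) - ((j : ℕ) : ℤ)| = 1

/-- The condition `|i - j| ≥ 2`. -/
def Far {n : ℕ} (i j : Fin (n - 1)) : Prop := 2 ≤ |((i : ℕ) : ℤ) - ((j : ℕ) : ℤ)|

/-- `BraidStep w w'`: the word `w'` is obtained from `w` by applying one braid relation,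
of type I (`s_i s_j s_i = s_j s_i s_j`, `|i - j| = 1`) or of type II (`s_i s_j = s_j s_i`,
`|i - j| ≥ 2`), to one factor of `w`. -/
inductive BraidStep {n : ℕ} : NExpr n → NExpr n → Prop
  | relI (x y : NExpr n) (i j : Fin (n - 1)) (h : Adjacent i j) :
      BraidStep (x ++ [i, j, i] ++ y) (x ++ [j, i, j] ++ y)
  | relII (x y : NExpr n) (i j : Fin (n - 1)) (h : Far i j) :
      BraidStep (x ++ [i, j] ++ y) (x ++ [j, i] ++ y)

/-- `BraidDerivation N w w'`: the word `w` can be transformed into `w'` by successively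
applying exactly `N` braid relations. -/
inductive BraidDerivation {n : ℕ} : ℕ → NExpr n → NExpr n → Prop
  | refl (w : NExpr n) : BraidDerivation 0 w w
  | step {N : ℕ} {w w' w'' : NExpr n} (h : BraidDerivation N w w') (h' : BraidStep w' w'') :
      BraidDerivation (N + 1) w w''

/-- The combinatorial distance: the minimal number of braid relations needed to transform
`w` into `w'`. It is `⊤` exactly when `w` cannot be transformed into `w'`. -/
noncomputable def combDist {n : ℕ} (w w' : NExpr n) : ℕ∞ :=
  ⨅ (N : ℕ) (_ : BraidDerivation N w w'), (N : ℕ∞)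

/-- Letters of extended expressions: `pos i` is `s_i`, drawn as a horizontal right-oriented
edge labeled `s_i`, and `neg i` is its formal copy, drawn as a vertical down-oriented edge
labeled `s_i`. -/
inductive ExtLetter (n : ℕ) : Type
  | pos (i : Fin (n - 1)) : ExtLetter n
  | neg (i : Fin (n - 1)) : ExtLetter n

/-- Extended `n`-expressions. An extended expression, read from left to right, is the list of
the edges of a path in the grid going from the bottom-left to the top-right: horizontal edges
are traversed rightwards, vertical edges are traversed upwards. -/
abbrev ExtExpr (n : ℕ) : Type := List (ExtLetter n)

/-- An expression seen as an extended expression (a horizontal path). -/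
def NExpr.toExt {n : ℕ} (u : NExpr n) : ExtExpr n := u.map ExtLetter.pos

/-- The extended expression obtained from the expression `u` by reversing the order of the
letters and replacing each `s_i` by its formal copy (a vertical path, which is labeled `u` when
it is read downwards). -/
def NExpr.bar {n : ℕ} (u : NExpr n) : ExtExpr n := (u.map ExtLetter.neg).reverse

/-- The types of tiles of a compacted reversing diagram. -/
inductive TileType : Type
  | I | Iprime | Isecond | II | III

/-- `Tile t p q`: there is a tile of type `t` whose left and top edges form the path `p` from
its bottom-left corner to its top-right corner, and whose bottom and right edges form the path
`q`. Tiles of types I, I', I'' are hexagons, tiles of type II are squares, tiles of type III are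
digons, whose bottom and right sides are an arc with the empty label, which contributes no
letter. -/
inductive Tile {n : ℕ} : TileType → ExtExpr n → ExtExpr n → Prop
  | typeI (i j : Fin (n - 1)) (h : Adjacent i j) :
      Tile TileType.I [.neg i, .pos j] [.pos j, .pos i, .neg j, .neg i]
  | typeIprime (i j : Fin (n - 1)) (h : Adjacent i j) :
      Tile TileType.Iprime [.neg i, .pos j, .pos i] [.pos j, .pos i, .neg j]
  | typeIsecond (i j : Fin (n - 1)) (h : Adjacent i j) :
      Tile TileType.Isecond [.neg j, .neg i, .pos j] [.pos i, .neg j, .neg i]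
  | typeII (i j : Fin (n - 1)) (h : Far i j) :
      Tile TileType.II [.neg i, .pos j] [.pos j, .neg i]
  | typeIII (i : Fin (n - 1)) :
      Tile TileType.III [.neg i, .pos i] []

/-- Compacted diagrams whose top-left boundary is the path `w₀` and whose bottom-right boundary
is the path `w`: starting from the path `w₀`, tiles are added one after the other, each of them
being glued along its left and top edges to a factor of the current bottom-right boundary. -/
inductive CompactedDiagram {n : ℕ} (w₀ : ExtExpr n) : ExtExpr n → Type
  | start : CompactedDiagram w₀ w₀
  | addTile {w w' : ExtExpr n} (D : CompactedDiagram w₀ w) (x p q y : ExtExpr n) (t : TileType)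
      (ht : Tile t p q) (hw : w = x ++ p ++ y) (hw' : w' = x ++ q ++ y) : CompactedDiagram w₀ w'

/-- The list of the types of the tiles of a compacted diagram. -/
def CompactedDiagram.tiles {n : ℕ} {w₀ w : ExtExpr n} : CompactedDiagram w₀ w → List TileType
  | .start => []
  | .addTile D _ _ _ _ t _ _ _ => t :: D.tiles

/-- A compacted reversing diagram for the pair of expressions `(u, v)`: it starts from a vertical
path labeled `u` and a horizontal path labeled `v` with a common source, and it is complete, so
that it finishes with a horizontal path labeled `v'` at the bottom and a vertical path labeled
`u'` on the right, with a common sink. -/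
structure CompactedReversingDiagram {n : ℕ} (u v : NExpr n) where
  /-- the label of the right vertical path -/
  u' : NExpr n
  /-- the label of the bottom horizontal path -/
  v' : NExpr n
  /-- the tiling -/
  diagram : CompactedDiagram (u.bar ++ v.toExt) (v'.toExt ++ u'.bar)

namespace CompactedReversingDiagram

variable {n : ℕ} {u v : NExpr n}

/-- The boundary word read from the source to the sink along the left and bottom sides. -/
def leftBottomWord (D : CompactedReversingDiagram u v) : NExpr n := u ++ D.v'

/-- The boundary word read from the source to the sink along the top and right sides. -/
def topRightWord (D : CompactedReversingDiagram u v) : NExpr n := v ++ D.u'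

/-- The diagram contains no digon: all tiles are of types I, I', I'' and II. -/
def NoDigon (D : CompactedReversingDiagram u v) : Prop := TileType.III ∉ D.diagram.tiles

/-- The number of nontrivial tiles, that is, the number of the tiles that remain (hexagons and
squares) when the arcs with an empty label, hence the digons, are collapsed. -/
noncomputable def numTiles (D : CompactedReversingDiagram u v) : ℕ :=
  open Classical in (D.diagram.tiles.filter (fun t => t ≠ TileType.III)).length

/-- The diagram is optimal: the number of tiles that remain after the arcs with an empty label
are collapsed is the combinatorial distance between the two boundary words. -/
def IsOptimal (D : CompactedReversingDiagram u v) : Prop :=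
  (D.numTiles : ℕ∞) = combDist D.leftBottomWord D.topRightWord

end CompactedReversingDiagram

/-!
Reading a braid word, name each letter by the two strands that cross there and by the number of
their earlier crossings. A braid relation permutes the names of the letters: type II exchanges two
letters on disjoint pairs of strands, type I reverses three letters `X Y Z` on three strands.

*A derivation is determined by its ends, up to cancellation.* Label a braid move by the
letters it permutes (`Label`), with a sign for its direction. The potential of a word is a Fox
derivative projected to the states of three strands, together with the relative order of letters on
disjoint pairs. A move changes the potential by its signed label plus labels of higher degree
(`contrib_neighbour`, `contrib_distant`), so the sum of the signed labels along a derivation can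
be recovered from its two end words (`Label.linearIndependent_boundary`). Therefore a derivation in
which no two moves have the same label and opposite signs is a shortest one.

*The tiles of a diagram form a derivation.* Each vertex of the current path carries a
word that leads to it from the source, and each edge a derivation between words; gluing a tile
adds one move to the total (`VertexWords`, `exists_isHinge`). At the end, this is a
derivation from `u v'` to `v u'` with one move for each tile.

*Without digons nothing cancels.* The final path consists of horizontal edges followed by
vertical ones. A tile other than a digon keeps all the names on the path, hence on each path of
the diagram the horizontal letters of a given pair of strands precede its vertical letters
(`PosBeforeNeg`). Consequently the number of crossings of this pair, viewed along the
path, first increases and then decreases, and each name occurs at most once horizontally and at most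
once vertically. If a tile has left letter `X` and top letter `Z` at its corner, and a later tile has
left letter `Z` and top letter `X`, then counting crossings shows that already on the first path there
is a horizontal `X` before a vertical `Z`; this persists (`Separated`), but is impossible when the
later tile is glued (`not_separated_of_hinge`). Two moves with the same label and opposite signs would
give such a pair of tiles (`exists_moves`).
-/

namespace BraidDistance

open Equiv

/-! ### Strand arrangements and named crossings -/

/-- The state reached by reading a word: `arr k` is the strand that occupies position `k`, and
`count e` is the number of crossings so far of the two strands of `e`. The strands and positions
range over all of `ℕ`, and counts are integers so that letters can also be undone. -/
@[ext]
structure Config where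
  arr : Equiv.Perm ℕ
  count : Sym2 ℕ → ℤ

/-- A letter of a word, named intrinsically: the pair of strands that cross there, and the number
of earlier crossings of the same two strands. Braid relations permute the named letters. -/
abbrev Name : Type := Sym2 ℕ × ℤ

namespace Config

/-- The state of the empty word. -/
def init : Config := ⟨1, 0⟩

/-- The two strands that meet at the positions `i`, `i + 1`. -/
def pair (s : Config) (i : ℕ) : Sym2 ℕ := s(s.arr i, s.arr (i + 1))

/-- The name of a letter `i` read in the state `s`. -/
def name (s : Config) (i : ℕ) : Name := (s.pair i, s.count (s.pair i))

/-- The state after a letter `i` is read forwards. -/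
def cross (s : Config) (i : ℕ) : Config :=
  ⟨s.arr * swap i (i + 1), s.count + Pi.single (s.pair i) 1⟩

/-- The state after a letter `i` is read backwards: the inverse of `cross`. -/
def uncross (s : Config) (i : ℕ) : Config :=
  ⟨s.arr * swap i (i + 1), s.count - Pi.single (s.pair i) 1⟩

@[simp] lemma cross_pair_self (s : Config) (i : ℕ) : (s.cross i).pair i = s.pair i := by
  simp [pair, cross, Sym2.eq_swap]

@[simp] lemma uncross_pair_self (s : Config) (i : ℕ) : (s.uncross i).pair i = s.pair i := by
  simp [pair, uncross, Sym2.eq_swap]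

@[simp] lemma uncross_cross (s : Config) (i : ℕ) : (s.cross i).uncross i = s := by
  have h := cross_pair_self s i
  ext1
  · simp [uncross, cross, mul_assoc]
  · simp only [uncross, h]; simp [cross]

@[simp] lemma cross_uncross (s : Config) (i : ℕ) : (s.uncross i).cross i = s := by
  have h := uncross_pair_self s i
  ext1
  · simp [uncross, cross, mul_assoc]
  · simp only [cross, h]; simp [uncross]

lemma count_cross_of_ne {s : Config} {i : ℕ} {e : Sym2 ℕ} (h : e ≠ s.pair i) :
    (s.cross i).count e = s.count e := by
  simp [cross, h]

lemma pair_ne {s : Config} {i j : ℕ} (h : i ≠ j) : s.pair i ≠ s.pair j := by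
  simp only [pair, ne_eq, Sym2.eq_iff, s.arr.injective.eq_iff]
  omega

/-- The condition `|i - j| = 1` on natural numbers. -/
def Neighbour (i j : ℕ) : Prop := j = i + 1 ∨ i = j + 1

/-- The condition `|i - j| ≥ 2` on natural numbers. -/
def Distant (i j : ℕ) : Prop := i + 2 ≤ j ∨ j + 2 ≤ i

lemma Neighbour.symm {i j : ℕ} (h : Neighbour i j) : Neighbour j i := Or.symm h

lemma Distant.symm {i j : ℕ} (h : Distant i j) : Distant j i := Or.symm h

lemma Neighbour.ne {i j : ℕ} (h : Neighbour i j) : i ≠ j := by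
  rcases h with h | h <;> omega

lemma Distant.ne {i j : ℕ} (h : Distant i j) : i ≠ j := by
  rcases h with h | h <;> omega

lemma swap_succ_add_two (i : ℕ) : swap i (i + 1) (i + 2) = i + 2 :=
  swap_apply_of_ne_of_ne (by omega) (by omega)

lemma swap_succ_succ_left (i : ℕ) : swap (i + 1) (i + 2) i = i :=
  swap_apply_of_ne_of_ne (by omega) (by omega)

/-- In `i, j, i` and `j, i, j` with `|i - j| = 1`, the middle letter is the crossing of the two
outer strands. -/
lemma cross_pair_succ (s : Config) (i : ℕ) :
    (s.cross i).pair (i + 1) = s(s.arr i, s.arr (i + 2)) := by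
  simp [pair, cross, swap_succ_add_two]

lemma cross_succ_pair (s : Config) (i : ℕ) :
    (s.cross (i + 1)).pair i = s(s.arr i, s.arr (i + 2)) := by
  simp [pair, cross, swap_succ_succ_left]

lemma cross_pair_comm (s : Config) {i j : ℕ} (h : Neighbour i j) :
    (s.cross i).pair j = (s.cross j).pair i := by
  rcases h with rfl | rfl
  · rw [cross_pair_succ, cross_succ_pair]
  · rw [cross_pair_succ, cross_succ_pair]

lemma cross_cross_pair (s : Config) {i j : ℕ} (h : Neighbour i j) :
    ((s.cross i).cross j).pair i = s.pair j := by
  rcases h with rfl | rfl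
  · simp [pair, cross, swap_succ_add_two, swap_succ_succ_left]
  · simp [pair, cross, swap_succ_add_two, swap_succ_succ_left]

lemma cross_pair_ne_left (s : Config) {i j : ℕ} (h : Neighbour i j) :
    (s.cross i).pair j ≠ s.pair i := by
  rw [← cross_pair_self s i]
  exact pair_ne h.ne.symm

lemma cross_pair_ne_right (s : Config) {i j : ℕ} (h : Neighbour i j) :
    (s.cross i).pair j ≠ s.pair j := by
  rw [cross_pair_comm s h]
  exact cross_pair_ne_left s h.symm

lemma cross_name_comm (s : Config) {i j : ℕ} (h : Neighbour i j) :
    (s.cross i).name j = (s.cross j).name i := by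
  unfold name
  rw [count_cross_of_ne (cross_pair_ne_left s h),
    count_cross_of_ne (cross_pair_ne_left s h.symm), cross_pair_comm s h]

/-- The first letter of `j, i, j` bears the same name as the last letter of `i, j, i`. -/
lemma cross_cross_name (s : Config) {i j : ℕ} (h : Neighbour i j) :
    ((s.cross i).cross j).name i = s.name j := by
  unfold name
  rw [cross_cross_pair s h, count_cross_of_ne (cross_pair_ne_right s h).symm,
    count_cross_of_ne (pair_ne h.ne.symm)]

lemma cross_pair_distant (s : Config) {i j : ℕ} (h : Distant i j) :
    (s.cross i).pair j = s.pair j := by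
  have h1 : swap i (i + 1) j = j := swap_apply_of_ne_of_ne (by rcases h with h | h <;> omega)
    (by rcases h with h | h <;> omega)
  have h2 : swap i (i + 1) (j + 1) = j + 1 :=
    swap_apply_of_ne_of_ne (by rcases h with h | h <;> omega)
    (by rcases h with h | h <;> omega)
  simp [pair, cross, h1, h2]

lemma cross_name_distant (s : Config) {i j : ℕ} (h : Distant i j) :
    (s.cross i).name j = s.name j := by
  unfold name
  rw [cross_pair_distant s h, count_cross_of_ne (pair_ne h.ne.symm)]

lemma cross_braid (s : Config) {i j : ℕ} (h : Neighbour i j) :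
    ((s.cross i).cross j).cross i = ((s.cross j).cross i).cross j := by
  ext1
  · wlog hij : j = i + 1 generalizing i j
    · exact (this h.symm (h.resolve_left hij)).symm
    subst hij
    simp only [cross, mul_assoc]
    congr 1
    have h1 := swap_mul_swap_mul_swap (x := i + 2) (y := i + 1) (z := i) (by omega) (by omega)
    have h2 := swap_mul_swap_mul_swap (x := i) (y := i + 1) (z := i + 2) (by omega) (by omega)
    rw [swap_comm (i + 1) i, swap_comm (i + 2) (i + 1)] at h1
    rw [← mul_assoc, ← mul_assoc, h1, h2, swap_comm]
  · have h1 := cross_cross_pair s h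
    have h2 := cross_cross_pair s h.symm
    have h3 := cross_pair_comm s h
    calc (((s.cross i).cross j).cross i).count
        = s.count + Pi.single (s.pair i) 1 + Pi.single ((s.cross i).pair j) 1
          + Pi.single (s.pair j) 1 := by rw [← h1]; rfl
      _ = s.count + Pi.single (s.pair j) 1 + Pi.single ((s.cross j).pair i) 1
          + Pi.single (s.pair i) 1 := by rw [h3]; abel
      _ = _ := by rw [← h2]; rfl

lemma cross_comm (s : Config) {i j : ℕ} (h : Distant i j) :
    (s.cross i).cross j = (s.cross j).cross i := by
  ext1
  · have hd : Perm.Disjoint (swap i (i + 1)) (swap j (j + 1)) := by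
      apply Perm.disjoint_swap_swap
      rcases h with h | h <;> simp <;> omega
    simp only [cross, mul_assoc, hd.commute.eq]
  · have h1 := cross_pair_distant s h
    have h2 := cross_pair_distant s h.symm
    calc ((s.cross i).cross j).count
        = s.count + Pi.single (s.pair i) 1 + Pi.single (s.pair j) 1 := by rw [← h1]; rfl
      _ = s.count + Pi.single (s.pair j) 1 + Pi.single (s.pair i) 1 := by abel
      _ = _ := by rw [← h2]; rfl

end Config

/-! ### Labels of braid moves and the potential -/

open Config

/-- A label for braid moves. `hex p q r α β γ` is the move on the three consecutive strands
`p`, `q`, `r` (from left to right), after `α`, `β`, `γ` crossings of `{p, q}`, `{p, r}`, `{q, r}`;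
`square X Z` is the exchange of the letters named `X` and `Z`. -/
inductive Label : Type
  | hex (p q r : ℕ) (α β γ : ℤ)
  | square (X Z : Name)
  deriving DecidableEq

namespace Label

/-- The number of earlier crossings inside the three strands of a hexagonal move. -/
def degree : Label → ℤ
  | hex _ _ _ α β γ => α + β + γ
  | square _ _ => 0

/-- The change of the potential caused by a move, see `contrib_neighbour` and `contrib_distant`.
For a hexagonal move this is the coefficient `1 - j + ij` of `i` in the difference of the Fox
derivatives of `iji` and `jij`, where `i` is the lower one of the two letters. -/
def boundary : Label → Label → ℤ
  | hex p q r α β γ =>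
      Pi.single (hex p q r α β γ) 1 - Pi.single (hex p r q β α (γ + 1)) 1
        + Pi.single (hex q r p γ (α + 1) (β + 1)) 1
  | square X Z => Pi.single (square X Z) 1

lemma boundary_self (a : Label) : a.boundary a = 1 := by
  rcases a with ⟨p, q, r, α, β, γ⟩ | ⟨X, Z⟩
  · have h1 : hex p q r α β γ ≠ hex p r q β α (γ + 1) := by
      intro h
      have := congrArg degree h
      simp only [degree] at this
      omega
    have h2 : hex p q r α β γ ≠ hex q r p γ (α + 1) (β + 1) := by
      intro h
      have := congrArg degree h
      simp only [degree] at this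
      omega
    simp [boundary, h1, h2]
  · simp [boundary]

lemma boundary_eq_zero {a b : Label} (hab : a ≠ b) (h : b.degree ≤ a.degree) :
    a.boundary b = 0 := by
  rcases a with ⟨p, q, r, α, β, γ⟩ | ⟨X, Z⟩
  · have h1 : b ≠ hex p r q β α (γ + 1) := by
      rintro rfl
      simp only [degree] at h
      omega
    have h2 : b ≠ hex q r p γ (α + 1) (β + 1) := by
      rintro rfl
      simp only [degree] at h
      omega
    simp [boundary, h1, h2, hab.symm]
  · simp [boundary, hab.symm]

/-- The boundary of a label is this label plus labels of higher degree, hence a nontrivial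
combination keeps its term of lowest degree. -/
theorem linearIndependent_boundary : LinearIndependent ℤ boundary := by
  rw [linearIndependent_iff]
  intro x hx
  by_contra hne
  -- `a` is a label of least degree in the support; no other boundary involves it.
  obtain ⟨a, ha, hmin⟩ :=
    x.support.exists_min_image degree (Finsupp.support_nonempty_iff.2 hne)
  have h := congrFun hx a
  rw [Finsupp.linearCombination_apply, Finsupp.sum, Finset.sum_apply,
    Finset.sum_eq_single_of_mem a ha] at h
  · simp [boundary_self] at h
    exact (Finsupp.mem_support_iff.1 ha) h
  · intro b hb hba
    simp [boundary_eq_zero hba (hmin b hb)]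

end Label

/-- The contribution to the potential of a letter `i` read in the state `s`. At `hex p q r α β γ`
it detects that `p`, `q` cross in this order, with `r` anywhere to the right of them, and with the
given counts. At `square X Z` it detects that the letter is named `X` and comes before the letter
`Z`; only disjoint pairs of strands are considered, and they are ordered by their smallest
strand so that each exchange has one label. -/
def contrib (s : Config) (i : ℕ) : Label → ℤ
  | .hex p q r α β γ =>
      if s.arr i = p ∧ s.arr (i + 1) = q ∧ i + 1 < s.arr.symm r ∧
        s.count s(p, q) = α ∧ s.count s(p, r) = β ∧ s.count s(q, r) = γ then 1 else 0
  | .square X Z =>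
      if s.name i = X ∧ Disjoint X.1.toFinset Z.1.toFinset ∧ X.1.inf < Z.1.inf ∧
        s.count Z.1 ≤ Z.2 then 1 else 0

/-- The label `hex p q r _ _ _`, where `p`, `q` are the strands at the positions `i`, `i + 1`. -/
def hexLabel (s : Config) (i r : ℕ) : Label :=
  .hex (s.arr i) (s.arr (i + 1)) r (s.count s(s.arr i, s.arr (i + 1))) (s.count s(s.arr i, r))
    (s.count s(s.arr (i + 1), r))

/-- The label of the braid move, applied in the state `s`, between the words `i, j, i` and
`j, i, j` if `|i - j| = 1`, and between `i, j` and `j, i` otherwise. -/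
def moveLabel (s : Config) (i j : ℕ) : Label :=
  if j = i + 1 then hexLabel s i (s.arr (i + 2))
  else if i = j + 1 then hexLabel s j (s.arr (j + 2))
  else if (s.pair i).inf < (s.pair j).inf then .square (s.name i) (s.name j)
  else .square (s.name j) (s.name i)

/-- The direction of the move from the word that starts with `i` to the word that starts with `j`,
relative to its label. -/
def moveSign (s : Config) (i j : ℕ) : ℤ :=
  if j = i + 1 then 1 else if i = j + 1 then -1
  else if (s.pair i).inf < (s.pair j).inf then 1 else -1

lemma swap_lt_iff {i k m : ℕ} (h : k < i ∨ i + 1 < k) : k < swap i (i + 1) m ↔ k < m := by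
  rw [swap_apply_def]
  split_ifs <;> omega

lemma contrib_hex_distant (s : Config) {i j : ℕ} (h : Distant i j) (p q r : ℕ) (α β γ : ℤ) :
    contrib (s.cross i) j (.hex p q r α β γ) = contrib s j (.hex p q r α β γ) := by
  have hp : swap i (i + 1) j = j := swap_apply_of_ne_of_ne (by rcases h with h | h <;> omega)
    (by rcases h with h | h <;> omega)
  have hq : swap i (i + 1) (j + 1) = j + 1 :=
    swap_apply_of_ne_of_ne (by rcases h with h | h <;> omega)
    (by rcases h with h | h <;> omega)
  have hr : ∀ t, s.count s(s.arr j, t) = (s.cross i).count s(s.arr j, t) := fun t => by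
    rw [count_cross_of_ne]
    simp only [pair, ne_eq, Sym2.eq_iff, s.arr.injective.eq_iff]
    rcases h with h | h <;> omega
  have hr' : ∀ t, s.count s(s.arr (j + 1), t) = (s.cross i).count s(s.arr (j + 1), t) := fun t => by
    rw [count_cross_of_ne]
    simp only [pair, ne_eq, Sym2.eq_iff, s.arr.injective.eq_iff]
    rcases h with h | h <;> omega
  have ht : j + 1 < (s.cross i).arr.symm r ↔ j + 1 < s.arr.symm r := by
    have : (s.cross i).arr.symm r = swap i (i + 1) (s.arr.symm r) := rfl
    rw [this, swap_lt_iff]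
    rcases h with h | h <;> omega
  simp only [contrib, ht]
  have ha : (s.cross i).arr j = s.arr j := by simp [cross, hp]
  have hb : (s.cross i).arr (j + 1) = s.arr (j + 1) := by simp [cross, hq]
  rw [ha, hb]
  refine if_congr ?_ rfl rfl
  constructor
  · rintro ⟨rfl, rfl, h3, h4, h5, h6⟩
    simp only [hr, hr', true_and]
    exact ⟨h3, h4, h5, h6⟩
  · rintro ⟨rfl, rfl, h3, h4, h5, h6⟩
    simp only [← hr, ← hr', true_and]
    exact ⟨h3, h4, h5, h6⟩

lemma pair_disjoint_of_distant (s : Config) {i j : ℕ} (h : Distant i j) :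
    Disjoint (s.pair i).toFinset (s.pair j).toFinset := by
  simp only [Finset.disjoint_left, pair, Sym2.mem_toFinset, Sym2.mem_iff]
  rintro a (rfl | rfl) <;> simp only [s.arr.injective.eq_iff] <;> rcases h with h | h <;> omega

lemma inf_pair_ne_of_distant (s : Config) {i j : ℕ} (h : Distant i j) :
    (s.pair i).inf ≠ (s.pair j).inf := by
  intro he
  have hm : ∀ i, (s.pair i).inf ∈ s.pair i := fun i => by
    simp only [pair, Sym2.inf_mk, Sym2.mem_iff]
    exact min_choice _ _
  exact Finset.disjoint_left.1 (pair_disjoint_of_distant s h)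
    (Sym2.mem_toFinset.2 (hm i)) (Sym2.mem_toFinset.2 (he ▸ hm j))

lemma contrib_square_sub (s : Config) {i j : ℕ} (h : Distant i j) (X Z : Name) :
    contrib s i (.square X Z) - contrib (s.cross j) i (.square X Z) =
      if (s.pair i).inf < (s.pair j).inf ∧ X = s.name i ∧ Z = s.name j then 1 else 0 := by
  have hd := pair_disjoint_of_distant s h
  simp only [contrib, cross_name_distant s h.symm]
  obtain ⟨e, k⟩ := Z
  by_cases hX : s.name i = X
  · subst hX
    by_cases he : e = s.pair j
    · subst he
      have : (s.cross j).count (s.pair j) = s.count (s.pair j) + 1 := by simp [cross]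
      simp only [this, name, Prod.mk.injEq, true_and]
      by_cases hlt : (s.pair i).inf < (s.pair j).inf
      · simp only [hd, hlt, true_and]
        split_ifs <;> omega
      · simp [hlt]
    · simp [count_cross_of_ne he, name, he]
  · simp [hX, Ne.symm hX]

/-- The effect on the potential of a type II relation. -/
theorem contrib_distant (s : Config) {i j : ℕ} (h : Distant i j) :
    contrib s i + contrib (s.cross i) j - (contrib s j + contrib (s.cross j) i) =
      moveSign s i j • (moveLabel s i j).boundary := by
  have h1 : j ≠ i + 1 := by rcases h with h | h <;> omega
  have h2 : i ≠ j + 1 := by rcases h with h | h <;> omega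
  have h3 := inf_pair_ne_of_distant s h
  simp only [moveSign, moveLabel, h1, h2, if_false]
  ext a
  rcases a with ⟨p, q, r, α, β, γ⟩ | ⟨X, Z⟩
  · have e1 := contrib_hex_distant s h p q r α β γ
    have e2 := contrib_hex_distant s h.symm p q r α β γ
    split_ifs <;> simp [e1, e2, Label.boundary] <;> ring
  · have e1 := contrib_square_sub s h X Z
    have e2 := contrib_square_sub s h.symm X Z
    have : (contrib s i + contrib (s.cross i) j - (contrib s j + contrib (s.cross j) i))
        (.square X Z) = (contrib s i (.square X Z) - contrib (s.cross j) i (.square X Z))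
          - (contrib s j (.square X Z) - contrib (s.cross i) j (.square X Z)) := by
      simp only [Pi.sub_apply, Pi.add_apply]; ring
    rw [this, e1, e2]
    rcases h3.lt_or_gt with hlt | hlt
    · simp [hlt, hlt.not_gt, Label.boundary, Pi.single_apply]
    · by_cases hc : X = s.name j ∧ Z = s.name i <;>
        simp [hlt, hlt.not_gt, Label.boundary, hc]

/-! ### The potential under type I relations -/

lemma contrib_square_congr {s t : Config} {i j : ℕ} {X Z : Name} (h : s.name i = t.name j)
    (hc : Disjoint (s.pair i).toFinset Z.1.toFinset → s.count Z.1 = t.count Z.1) :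
    contrib s i (.square X Z) = contrib t j (.square X Z) := by
  simp only [contrib, h]
  refine if_congr ?_ rfl rfl
  refine and_congr_right fun hX => and_congr_right fun hd => ?_
  subst hX
  rw [hc]
  have : s.pair i = (t.name j).1 := congrArg Prod.fst h
  rwa [this]

lemma cross_arr (s : Config) (i k : ℕ) : (s.cross i).arr k = s.arr (swap i (i + 1) k) := rfl

lemma cross_arr_symm (s : Config) (i k : ℕ) :
    (s.cross i).arr.symm k = swap i (i + 1) (s.arr.symm k) := rfl

lemma cross_count (s : Config) (i : ℕ) (e : Sym2 ℕ) :
    (s.cross i).count e = s.count e + if e = s.pair i then 1 else 0 := by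
  simp [cross, Pi.single_apply]

lemma contrib_hex_eq (s : Config) (i p q r : ℕ) (α β γ : ℤ) :
    contrib s i (.hex p q r α β γ) =
      if i + 1 < s.arr.symm r ∧ Label.hex p q r α β γ = hexLabel s i r then 1 else 0 := by
  simp only [contrib, hexLabel, Label.hex.injEq]
  grind

/-- Two crossings of the same strands `p`, `q` are compared. If the same strands are to the right of
both, with the same counts, except for a strand `T` that is to the right of the first one only, then
the contributions differ at one label. -/
lemma contrib_hex_sub {s t : Config} {i k : ℕ} (T : ℕ) (hs : i + 1 < s.arr.symm T)
    (ht : ¬ k + 1 < t.arr.symm T)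
    (h : ∀ r, r ≠ T → (i + 1 < s.arr.symm r ↔ k + 1 < t.arr.symm r) ∧
      (i + 1 < s.arr.symm r → hexLabel s i r = hexLabel t k r))
    (p q r : ℕ) (α β γ : ℤ) :
    contrib s i (.hex p q r α β γ) - contrib t k (.hex p q r α β γ) =
      Pi.single (M := fun _ => ℤ) (hexLabel s i T) 1 (.hex p q r α β γ) := by
  rw [contrib_hex_eq, contrib_hex_eq, Pi.single_apply]
  by_cases hr : r = T
  · subst hr
    simp [hs, ht]
  · have : Label.hex p q r α β γ ≠ hexLabel s i T := by
      simp [hexLabel, hr]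
    obtain ⟨h1, h2⟩ := h r hr
    rw [if_neg this]
    simp only [← h1]
    by_cases hi : i + 1 < s.arr.symm r
    · rw [h2 hi, sub_self]
    · simp [hi]

section HexagonalMoves

variable (s : Config) (i p q r : ℕ) (α β γ : ℤ)

lemma contrib_hex_sub_first :
    contrib s i (.hex p q r α β γ) - contrib ((s.cross (i + 1)).cross i) (i + 1) (.hex p q r α β γ)
      = Pi.single (M := fun _ => ℤ) (hexLabel s i (s.arr (i + 2))) 1 (.hex p q r α β γ) := by
  have h1 : swap i (i + 1) (i + 2) = i + 2 := swap_succ_add_two i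
  have h2 : swap (i + 1) (i + 2) i = i := swap_succ_succ_left i
  refine contrib_hex_sub _ ?_ ?_ (fun r hr => ?_) p q r α β γ
  · simp
  · simp [cross_arr_symm]; omega
  · obtain ⟨m, rfl⟩ := s.arr.surjective r
    replace hr : m ≠ i + 2 := fun h => hr (h ▸ rfl)
    constructor
    · simp only [cross_arr_symm, symm_apply_apply, swap_apply_def]
      grind
    · intro hm
      simp only [symm_apply_apply] at hm
      simp only [hexLabel, cross_arr, h1, h2, swap_apply_left, swap_apply_right, cross_count,
        Label.hex.injEq, true_and, pair, Sym2.eq_iff, s.arr.injective.eq_iff]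
      grind

lemma contrib_hex_sub_middle :
    contrib (s.cross (i + 1)) i (.hex p q r α β γ) - contrib (s.cross i) (i + 1) (.hex p q r α β γ)
      = Pi.single (M := fun _ => ℤ) (hexLabel (s.cross (i + 1)) i (s.arr (i + 1))) 1
          (.hex p q r α β γ) := by
  have h1 : swap i (i + 1) (i + 2) = i + 2 := swap_succ_add_two i
  have h2 : swap (i + 1) (i + 2) i = i := swap_succ_succ_left i
  refine contrib_hex_sub _ ?_ ?_ (fun r hr => ?_) p q r α β γ
  · simp [cross_arr_symm]
  · simp [cross_arr_symm]; omega
  · obtain ⟨m, rfl⟩ := s.arr.surjective r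
    replace hr : m ≠ i + 1 := fun h => hr (h ▸ rfl)
    constructor
    · simp only [cross_arr_symm, symm_apply_apply, swap_apply_def]
      grind
    · intro hm
      simp only [cross_arr_symm, symm_apply_apply, swap_apply_def] at hm
      simp only [hexLabel, cross_arr, h1, h2, swap_apply_left, swap_apply_right, cross_count,
        Label.hex.injEq, true_and, pair, Sym2.eq_iff, s.arr.injective.eq_iff]
      grind

lemma contrib_hex_sub_last :
    contrib ((s.cross i).cross (i + 1)) i (.hex p q r α β γ) - contrib s (i + 1) (.hex p q r α β γ)
      = Pi.single (M := fun _ => ℤ) (hexLabel ((s.cross i).cross (i + 1)) i (s.arr i)) 1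
          (.hex p q r α β γ) := by
  have h1 : swap i (i + 1) (i + 2) = i + 2 := swap_succ_add_two i
  have h2 : swap (i + 1) (i + 2) i = i := swap_succ_succ_left i
  refine contrib_hex_sub _ ?_ ?_ (fun r hr => ?_) p q r α β γ
  · simp [cross_arr_symm]
  · simp; omega
  · obtain ⟨m, rfl⟩ := s.arr.surjective r
    replace hr : m ≠ i := fun h => hr (h ▸ rfl)
    constructor
    · simp only [cross_arr_symm, symm_apply_apply, swap_apply_def]
      grind
    · intro hm
      simp only [cross_arr_symm, symm_apply_apply, swap_apply_def] at hm
      simp only [hexLabel, cross_arr, h1, h2, swap_apply_left, swap_apply_right, cross_count,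
        Label.hex.injEq, true_and, pair, Sym2.eq_iff, s.arr.injective.eq_iff]
      grind

lemma boundary_hexLabel :
    (hexLabel s i (s.arr (i + 2))).boundary =
      Pi.single (hexLabel s i (s.arr (i + 2))) 1
        - Pi.single (hexLabel (s.cross (i + 1)) i (s.arr (i + 1))) 1
        + Pi.single (hexLabel ((s.cross i).cross (i + 1)) i (s.arr i)) 1 := by
  have h1 : swap i (i + 1) (i + 2) = i + 2 := swap_succ_add_two i
  have h2 : swap (i + 1) (i + 2) i = i := swap_succ_succ_left i
  have e1 : hexLabel (s.cross (i + 1)) i (s.arr (i + 1)) =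
      .hex (s.arr i) (s.arr (i + 2)) (s.arr (i + 1)) (s.count s(s.arr i, s.arr (i + 2)))
        (s.count s(s.arr i, s.arr (i + 1))) (s.count s(s.arr (i + 1), s.arr (i + 2)) + 1) := by
    simp only [hexLabel, cross_arr, h2, swap_apply_left, cross_count,
      Label.hex.injEq, true_and, pair, Sym2.eq_iff, s.arr.injective.eq_iff]
    simp [Sym2.eq_swap]
    omega
  have e2 : hexLabel ((s.cross i).cross (i + 1)) i (s.arr i) =
      .hex (s.arr (i + 1)) (s.arr (i + 2)) (s.arr i) (s.count s(s.arr (i + 1), s.arr (i + 2)))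
        (s.count s(s.arr i, s.arr (i + 1)) + 1) (s.count s(s.arr i, s.arr (i + 2)) + 1) := by
    simp only [hexLabel, cross_arr, h1, h2, swap_apply_left, swap_apply_right, cross_count,
      Label.hex.injEq, true_and, pair, Sym2.eq_iff, s.arr.injective.eq_iff]
    simp [Sym2.eq_swap]
  rw [e1, e2]
  rfl

lemma contrib_succ :
    contrib s i + contrib (s.cross i) (i + 1) + contrib ((s.cross i).cross (i + 1)) i
      - (contrib s (i + 1) + contrib (s.cross (i + 1)) i
        + contrib ((s.cross (i + 1)).cross i) (i + 1)) =
      (hexLabel s i (s.arr (i + 2))).boundary := by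
  have hn : Neighbour i (i + 1) := Or.inl rfl
  ext a
  rcases a with ⟨p, q, r, α, β, γ⟩ | ⟨X, Z⟩
  · have e1 := contrib_hex_sub_first s i p q r α β γ
    have e2 := contrib_hex_sub_middle s i p q r α β γ
    have e3 := contrib_hex_sub_last s i p q r α β γ
    rw [boundary_hexLabel]
    simp only [Pi.add_apply, Pi.sub_apply]
    linarith
  · have hA : s.arr i ∈ s.pair i := by simp [pair]
    have hB : s.arr (i + 1) ∈ s.pair i := by simp [pair]
    have hB' : s.arr (i + 1) ∈ s.pair (i + 1) := by simp [pair]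
    have hC' : s.arr (i + 2) ∈ s.pair (i + 1) := by simp [pair]
    have hA' : s.arr i ∈ (s.cross i).pair (i + 1) := by simp [cross_pair_succ]
    have hC : s.arr (i + 2) ∈ (s.cross i).pair (i + 1) := by simp [cross_pair_succ]
    have hY := cross_pair_comm s hn
    have key : ∀ {e f : Sym2 ℕ} {x : ℕ}, x ∈ e → x ∈ f → Disjoint e.toFinset Z.1.toFinset →
        Z.1 ≠ f := by
      rintro e f x he hf hd rfl
      exact Finset.disjoint_left.1 hd (Sym2.mem_toFinset.2 he) (Sym2.mem_toFinset.2 hf)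
    have e1 : contrib s i (.square X Z) =
        contrib ((s.cross (i + 1)).cross i) (i + 1) (.square X Z) := by
      refine contrib_square_congr (cross_cross_name s hn.symm).symm fun hd => ?_
      rw [count_cross_of_ne (hY ▸ key hA hA' hd), count_cross_of_ne (key hB hB' hd)]
    have e2 : contrib (s.cross i) (i + 1) (.square X Z) =
        contrib (s.cross (i + 1)) i (.square X Z) := by
      refine contrib_square_congr (cross_name_comm s hn) fun hd => ?_
      rw [count_cross_of_ne (key hA' hA hd), count_cross_of_ne (key hC hC' hd)]
    have e3 : contrib s (i + 1) (.square X Z) =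
        contrib ((s.cross i).cross (i + 1)) i (.square X Z) := by
      refine contrib_square_congr (cross_cross_name s hn).symm fun hd => ?_
      rw [count_cross_of_ne (key hC' hC hd), count_cross_of_ne (key hB' hB hd)]
    simp only [Pi.add_apply, Pi.sub_apply, e1, e2, e3]
    simp only [hexLabel, Label.boundary]
    simp
    ring

/-- The effect on the potential of a type I relation. -/
theorem contrib_neighbour {i j : ℕ} (h : Neighbour i j) :
    contrib s i + contrib (s.cross i) j + contrib ((s.cross i).cross j) i
      - (contrib s j + contrib (s.cross j) i + contrib ((s.cross j).cross i) j) =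
      moveSign s i j • (moveLabel s i j).boundary := by
  rcases h with rfl | rfl
  · simp [moveSign, moveLabel, contrib_succ]
  · rw [← neg_sub, contrib_succ]
    have : j ≠ j + 1 + 1 := by omega
    simp [moveSign, moveLabel, this]

end HexagonalMoves

/-! ### Derivations -/

variable {n : ℕ}

/-- The state reached from `s` by reading a word. -/
def crossWord (s : Config) : NExpr n → Config
  | [] => s
  | i :: w => crossWord (s.cross i) w

/-- The sum of the contributions of the letters of a word read from the state `s`. -/
def potential (s : Config) : NExpr n → Label → ℤ
  | [] => 0
  | i :: w => contrib s i + potential (s.cross i) w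

lemma crossWord_append (s : Config) (w z : NExpr n) :
    crossWord s (w ++ z) = crossWord (crossWord s w) z := by
  induction w generalizing s with
  | nil => rfl
  | cons i w ih => exact ih _

lemma potential_append (s : Config) (w z : NExpr n) :
    potential s (w ++ z) = potential s w + potential (crossWord s w) z := by
  induction w generalizing s with
  | nil => simp [potential, crossWord]
  | cons i w ih => simp [potential, crossWord, ih, add_assoc]

lemma neighbour_of_adjacent {i j : Fin (n - 1)} (h : Adjacent i j) : Neighbour i j := by
  unfold Adjacent at h
  unfold Neighbour
  rcases abs_eq (by norm_num : (0 : ℤ) ≤ 1) |>.1 h with h | h <;> omega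

lemma distant_of_far {i j : Fin (n - 1)} (h : Far i j) : Distant i j := by
  unfold Far at h
  unfold Distant
  rcases le_abs.1 h with h | h <;> omega

/-- A braid move as a signed label. -/
noncomputable def moveVector (s : Config) (i j : ℕ) : Label →₀ ℤ :=
  Finsupp.single (moveLabel s i j) (moveSign s i j)

/-- The linear extension of `Label.boundary`. -/
noncomputable def boundaryMap : (Label →₀ ℤ) →ₗ[ℤ] (Label → ℤ) :=
  Finsupp.linearCombination ℤ Label.boundary

lemma boundaryMap_injective : Function.Injective boundaryMap :=
  Label.linearIndependent_boundary

lemma boundaryMap_moveVector (s : Config) (i j : ℕ) :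
    boundaryMap (moveVector s i j) = moveSign s i j • (moveLabel s i j).boundary := by
  simp [boundaryMap, moveVector]

lemma abs_moveSign (s : Config) (i j : ℕ) : |moveSign s i j| = 1 := by
  unfold moveSign
  split_ifs <;> rfl

lemma crossWord_relI (s : Config) {i j : Fin (n - 1)} (h : Adjacent i j) :
    crossWord s [i, j, i] = crossWord s [j, i, j] :=
  cross_braid s (neighbour_of_adjacent h)

lemma crossWord_relII (s : Config) {i j : Fin (n - 1)} (h : Far i j) :
    crossWord s [i, j] = crossWord s [j, i] :=
  cross_comm s (distant_of_far h)

lemma potential_relI (s : Config) {i j : Fin (n - 1)} (h : Adjacent i j) :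
    boundaryMap (moveVector s i j) = potential s [i, j, i] - potential s [j, i, j] := by
  rw [boundaryMap_moveVector, ← contrib_neighbour s (neighbour_of_adjacent h)]
  simp only [potential, add_zero]
  abel

lemma potential_relII (s : Config) {i j : Fin (n - 1)} (h : Far i j) :
    boundaryMap (moveVector s i j) = potential s [i, j] - potential s [j, i] := by
  rw [boundaryMap_moveVector, ← contrib_distant s (distant_of_far h)]
  simp only [potential, add_zero]

lemma potential_congr_factor (s : Config) {l r : NExpr n} (x y : NExpr n)
    (h : crossWord (crossWord s x) l = crossWord (crossWord s x) r) :
    potential s (x ++ l ++ y) - potential s (x ++ r ++ y) =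
      potential (crossWord s x) l - potential (crossWord s x) r := by
  simp only [potential_append, crossWord_append, h]
  abel

lemma braidStep_crossWord {w w' : NExpr n} (h : BraidStep w w') (s : Config) :
    crossWord s w = crossWord s w' := by
  cases h with
  | relI x y i j h => simp only [crossWord_append, crossWord_relI _ h]
  | relII x y i j h => simp only [crossWord_append, crossWord_relII _ h]

lemma braidDerivation_crossWord {N : ℕ} {w w' : NExpr n} (h : BraidDerivation N w w')
    (s : Config) : crossWord s w = crossWord s w' := by
  induction h with
  | refl => rfl
  | step _ h' ih => rw [ih, braidStep_crossWord h']

lemma braidStep_moveVector {w w' : NExpr n} (h : BraidStep w w') (s : Config) :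
    ∃ (t : Config) (i j : ℕ),
      boundaryMap (moveVector t i j) = potential s w - potential s w' := by
  cases h with
  | relI x y i j h =>
    refine ⟨crossWord s x, i, j, ?_⟩
    rw [potential_congr_factor _ _ _ (crossWord_relI _ h), potential_relI _ h]
  | relII x y i j h =>
    refine ⟨crossWord s x, i, j, ?_⟩
    rw [potential_congr_factor _ _ _ (crossWord_relII _ h), potential_relII _ h]

lemma linearCombination_moveVector_le {f : Label → ℤ} (hf : ∀ a, |f a| ≤ 1) (s : Config)
    (i j : ℕ) : Finsupp.linearCombination ℤ f (moveVector s i j) ≤ 1 := by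
  rw [moveVector, Finsupp.linearCombination_single, smul_eq_mul]
  calc _ ≤ |moveSign s i j * f (moveLabel s i j)| := le_abs_self _
    _ ≤ 1 := by rw [abs_mul, abs_moveSign, one_mul]; exact hf _

/-- The sum `x` of the signed labels along a derivation has its boundary determined by the two
end words, and a functional bounded by `1` bounds the length of the derivation from below. -/
theorem BraidDerivation.exists_vector {N : ℕ} {w w' : NExpr n} (h : BraidDerivation N w w')
    (s : Config) : ∃ x : Label →₀ ℤ, boundaryMap x = potential s w - potential s w' ∧
      ∀ f : Label → ℤ, (∀ a, |f a| ≤ 1) → Finsupp.linearCombination ℤ f x ≤ N := by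
  induction h with
  | refl => exact ⟨0, by simp, by simp⟩
  | step _ h' ih =>
    obtain ⟨x, hx, hle⟩ := ih
    obtain ⟨t, i, j, ht⟩ := braidStep_moveVector h' s
    refine ⟨x + moveVector t i j, by rw [map_add, hx, ht]; abel, fun f hf => ?_⟩
    rw [map_add, Nat.cast_add, Nat.cast_one]
    exact add_le_add (hle f hf) (linearCombination_moveVector_le hf t i j)

/-- The sum of the signed labels of some braid moves, together with their number. -/
abbrev Cost : Type := (Label →₀ ℤ) × ℕ

/-- There is a derivation of length `κ.2` from `w` to `w'`, and `κ.1` has the boundary of such a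
derivation. -/
def Derives (w w' : NExpr n) (κ : Cost) : Prop :=
  BraidDerivation κ.2 w w' ∧ boundaryMap κ.1 = potential init w - potential init w'

lemma BraidDerivation.trans {M N : ℕ} {a b c : NExpr n} (h : BraidDerivation M a b)
    (h' : BraidDerivation N b c) : BraidDerivation (M + N) a c := by
  induction h' with
  | refl => exact h
  | step _ h'' ih => exact (ih h).step h''

lemma BraidStep.append {a b : NExpr n} (h : BraidStep a b) (c : NExpr n) :
    BraidStep (a ++ c) (b ++ c) := by
  cases h with
  | relI x y i j h => simpa using BraidStep.relI x (y ++ c) i j h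
  | relII x y i j h => simpa using BraidStep.relII x (y ++ c) i j h

lemma BraidDerivation.append {N : ℕ} {a b : NExpr n} (h : BraidDerivation N a b) (c : NExpr n) :
    BraidDerivation N (a ++ c) (b ++ c) := by
  induction h with
  | refl => exact .refl _
  | step _ h' ih => exact ih.step (BraidStep.append h' c)

namespace Derives

lemma refl (w : NExpr n) : Derives w w 0 :=
  ⟨.refl w, by simp⟩

lemma trans {a b c : NExpr n} {κ μ : Cost} (h : Derives a b κ) (h' : Derives b c μ) :
    Derives a c (κ + μ) :=
  ⟨BraidDerivation.trans h.1 h'.1, by rw [Prod.fst_add, map_add, h.2, h'.2]; abel⟩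

lemma append {a b : NExpr n} {κ : Cost} (h : Derives a b κ) (c : NExpr n) :
    Derives (a ++ c) (b ++ c) κ :=
  ⟨BraidDerivation.append h.1 c, by
    rw [h.2, potential_append, potential_append, braidDerivation_crossWord h.1]; abel⟩

lemma crossWord_eq {a b : NExpr n} {κ : Cost} (h : Derives a b κ) :
    crossWord init a = crossWord init b :=
  braidDerivation_crossWord h.1 _

lemma crossWord_eq_of_cross {a b : NExpr n} {i : Fin (n - 1)} {κ : Cost} {s : Config}
    (h : Derives a (b ++ [i]) κ) (hs : crossWord init a = s.cross i) : crossWord init b = s := by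
  have := h.crossWord_eq
  rw [hs, crossWord_append] at this
  have := congrArg (fun t : Config => t.uncross i) this
  simpa [crossWord] using this.symm

lemma relI (b : NExpr n) {i j : Fin (n - 1)} (h : Adjacent i j) :
    Derives (b ++ [i, j, i]) (b ++ [j, i, j]) (moveVector (crossWord init b) i j, 1) :=
  ⟨.step (.refl _) (by simpa using BraidStep.relI b [] i j h), by
    rw [potential_relI _ h, potential_append, potential_append]; abel⟩

lemma relII (b : NExpr n) {i j : Fin (n - 1)} (h : Far i j) :
    Derives (b ++ [i, j]) (b ++ [j, i]) (moveVector (crossWord init b) i j, 1) :=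
  ⟨.step (.refl _) (by simpa using BraidStep.relII b [] i j h), by
    rw [potential_relII _ h, potential_append, potential_append]; abel⟩

end Derives

/-! ### Words at the vertices of a path -/

/-- The vertices of the path `w` can be labelled by words, which read the way from the source of the
diagram to the vertex, such that the first one is `a` and the last one is `b`. If a horizontal edge
with letter `i` goes from the word `c` to the word `d`, then `c i` derives `d`; if a vertical edge goes
up from `c` to `d`, then `c` derives `d i`. The total cost of these derivations is `κ`. -/
def VertexWords (a : NExpr n) : ExtExpr n → NExpr n → Cost → Prop
  | [], b, κ => a = b ∧ κ = 0
  | .pos i :: w, b, κ => ∃ a' μ ν, Derives (a ++ [i]) a' μ ∧ VertexWords a' w b ν ∧ κ = μ + ν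
  | .neg i :: w, b, κ => ∃ a' μ ν, Derives a (a' ++ [i]) μ ∧ VertexWords a' w b ν ∧ κ = μ + ν

lemma vertexWords_append {a b : NExpr n} {x w : ExtExpr n} {κ : Cost} :
    VertexWords a (x ++ w) b κ ↔ ∃ c μ ν, VertexWords a x c μ ∧ VertexWords c w b ν ∧ κ = μ + ν := by
  induction x generalizing a κ with
  | nil => 
    constructor
    · exact fun h => ⟨a, 0, κ, ⟨rfl, rfl⟩, h, (zero_add κ).symm⟩
    · rintro ⟨c, μ, ν, ⟨rfl, rfl⟩, h, rfl⟩
      simpa using h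
  | cons e x ih =>
    cases e <;>
    · simp only [List.cons_append, VertexWords, ih]
      constructor
      · rintro ⟨a', μ, ν, h1, ⟨c, μ', ν', h2, h3, rfl⟩, rfl⟩
        exact ⟨c, μ + μ', ν', ⟨a', μ, μ', h1, h2, rfl⟩, h3, (add_assoc _ _ _).symm⟩
      · rintro ⟨c, μ, ν, ⟨a', μ', ν', h1, h2, rfl⟩, h3, rfl⟩
        exact ⟨a', μ', ν' + ν, h1, ⟨c, ν', ν, h2, h3, rfl⟩, add_assoc _ _ _⟩

lemma vertexWords_toExt {a b : NExpr n} {v : NExpr n} {κ : Cost} (h : VertexWords a v.toExt b κ) :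
    Derives (a ++ v) b κ := by
  induction v generalizing a κ with
  | nil =>
    obtain ⟨rfl, rfl⟩ := h
    simpa using Derives.refl a
  | cons i v ih =>
    obtain ⟨a', μ, ν, h1, h2, rfl⟩ := h
    have := (h1.append v).trans (ih h2)
    rwa [List.append_assoc, List.singleton_append] at this

lemma vertexWords_bar {a b : NExpr n} {u : NExpr n} {κ : Cost} (h : VertexWords a u.bar b κ) :
    Derives a (b ++ u) κ := by
  induction u generalizing b κ with
  | nil =>
    obtain ⟨rfl, rfl⟩ := h
    simpa using Derives.refl a
  | cons i u ih =>
    have hb : NExpr.bar (i :: u) = NExpr.bar u ++ [.neg i] := by simp [NExpr.bar]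
    rw [hb, vertexWords_append] at h
    obtain ⟨c, μ, ν, h1, ⟨a', μ', ν', h2, ⟨rfl, rfl⟩, rfl⟩, rfl⟩ := h
    have := (ih h1).trans (h2.append u)
    simpa using this

lemma vertexWords_toExt_self (a v : NExpr n) : VertexWords a v.toExt (a ++ v) 0 := by
  induction v generalizing a with
  | nil => exact ⟨by simp, rfl⟩
  | cons i v ih => exact ⟨a ++ [i], 0, 0, .refl _, List.append_cons a i v ▸ ih (a ++ [i]), by simp⟩

lemma vertexWords_bar_self (b u : NExpr n) : VertexWords (b ++ u) u.bar b 0 := by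
  induction u generalizing b with
  | nil => exact ⟨by simp, rfl⟩
  | cons i u ih =>
    have hb : NExpr.bar (i :: u) = NExpr.bar u ++ [.neg i] := by simp [NExpr.bar]
    rw [hb, vertexWords_append]
    exact ⟨b ++ [i], 0, 0, by simpa using ih (b ++ [i]), ⟨b, 0, 0, .refl _, ⟨rfl, rfl⟩, by simp⟩,
      by simp⟩

/-! ### Named letters on a path -/

lemma uncross_count (s : Config) (i : ℕ) (e : Sym2 ℕ) :
    (s.uncross i).count e = s.count e - if e = s.pair i then 1 else 0 := by
  simp [uncross, Pi.single_apply]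

/-- The state at the end of a path that starts in the state `s`. -/
def run (s : Config) : ExtExpr n → Config
  | [] => s
  | .pos i :: w => run (s.cross i) w
  | .neg i :: w => run (s.uncross i) w

/-- A named letter on a path, with `true` for a horizontal and `false` for a vertical edge. -/
abbrev Event : Type := Name × Bool

/-- The named letters on a path that starts in the state `s`. A vertical edge is traversed against
its orientation, so its name is read in the state at its upper end. -/
def events (s : Config) : ExtExpr n → List Event
  | [] => []
  | .pos i :: w => (s.name i, true) :: events (s.cross i) w
  | .neg i :: w => ((s.uncross i).name i, false) :: events (s.uncross i) w

lemma run_append (s : Config) (x w : ExtExpr n) : run s (x ++ w) = run (run s x) w := by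
  induction x generalizing s with
  | nil => rfl
  | cons e x ih => cases e <;> exact ih _

lemma events_append (s : Config) (x w : ExtExpr n) :
    events s (x ++ w) = events s x ++ events (run s x) w := by
  induction x generalizing s with
  | nil => rfl
  | cons e x ih => cases e <;> simp [events, run, ih]

lemma VertexWords.run_eq {a b : NExpr n} {w : ExtExpr n} {κ : Cost} (h : VertexWords a w b κ) :
    run (crossWord init a) w = crossWord init b := by
  induction w generalizing a κ with
  | nil => rw [h.1]; rfl
  | cons e w ih =>
    cases e with
    | pos i =>
      obtain ⟨a', μ, ν, h1, h2, rfl⟩ := h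
      have := h1.crossWord_eq
      rw [crossWord_append] at this
      rw [← ih h2, ← this]
      rfl
    | neg i =>
      obtain ⟨a', μ, ν, h1, h2, rfl⟩ := h
      have := h1.crossWord_eq
      rw [crossWord_append] at this
      rw [← ih h2]
      simp [run, this, crossWord]

/-- Along a path the count of a pair changes by `±1`, so a count that comes down through a level at
or above its initial value has come up through it. -/
lemma true_mem_events {s : Config} {w : ExtExpr n} {e : Sym2 ℕ} {k : ℤ}
    (h : ((e, k), false) ∈ events s w) (hs : s.count e ≤ k) : ((e, k), true) ∈ events s w := by
  induction w generalizing s with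
  | nil => simp [events] at h
  | cons l w ih =>
    cases l with
    | pos i =>
      simp only [events, name, List.mem_cons, Prod.mk.injEq, reduceCtorEq, and_false,
        false_or, and_true] at h ⊢
      by_cases hc : (s.cross i).count e ≤ k
      · exact Or.inr (ih h hc)
      · rw [cross_count] at hc
        split_ifs at hc with he
        · subst he
          exact Or.inl ⟨rfl, by omega⟩
        · omega
    | neg i =>
      simp only [events, name, List.mem_cons, Prod.mk.injEq, reduceCtorEq, and_false,
        false_or, and_true] at h ⊢
      have hu := uncross_count s i e
      rcases h with ⟨rfl, rfl⟩ | h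
      · simp only [uncross_pair_self, if_true] at hs hu
        omega
      · exact ih h (by rw [hu]; split_ifs <;> omega)

lemma false_mem_events_of_lt {s : Config} {w : ExtExpr n} {e : Sym2 ℕ} {k : ℤ}
    (hs : k < s.count e) (hw : (run s w).count e ≤ k) : ((e, k), false) ∈ events s w := by
  induction w generalizing s with
  | nil => simp only [run] at hw; omega
  | cons l w ih =>
    cases l with
    | pos i =>
      refine List.mem_cons_of_mem _ (ih ?_ hw)
      rw [cross_count]
      split_ifs <;> omega
    | neg i =>
      by_cases hc : k < (s.uncross i).count e
      · exact List.mem_cons_of_mem _ (ih hc hw)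
      · have hu := uncross_count s i e
        split_ifs at hu with he
        · have hk : (s.uncross i).count e = k := by omega
          subst he
          simp [events, name, hk]
        · omega

/-- A count that goes up through a level at or above its final value comes down through it. -/
lemma false_mem_events {s : Config} {w : ExtExpr n} {e : Sym2 ℕ} {k : ℤ}
    (h : ((e, k), true) ∈ events s w) (hw : (run s w).count e ≤ k) :
    ((e, k), false) ∈ events s w := by
  induction w generalizing s with
  | nil => simp [events] at h
  | cons l w ih =>
    cases l with
    | pos i =>
      rcases List.mem_cons.1 h with h | h
      · simp only [name, Prod.mk.injEq, and_true] at h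
        obtain ⟨rfl, rfl⟩ := h
        exact List.mem_cons_of_mem _ (false_mem_events_of_lt (by simp [cross_count]) hw)
      · exact List.mem_cons_of_mem _ (ih h hw)
    | neg i =>
      rcases List.mem_cons.1 h with h | h
      · simp at h
      · exact List.mem_cons_of_mem _ (ih h hw)

lemma count_le_run {s : Config} {w : ExtExpr n} {e : Sym2 ℕ}
    (h : ∀ k, ((e, k), false) ∉ events s w) : s.count e ≤ (run s w).count e := by
  by_contra! hlt
  exact h _ (false_mem_events_of_lt hlt le_rfl)

lemma lt_run_count {s : Config} {w : ExtExpr n} {e : Sym2 ℕ} {k : ℤ}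
    (h : ∀ k, ((e, k), false) ∉ events s w) (hk : ((e, k), true) ∈ events s w) :
    k < (run s w).count e := by
  by_contra! hle
  exact h _ (false_mem_events hk hle)

lemma lt_count {s : Config} {w : ExtExpr n} {e : Sym2 ℕ} {k : ℤ}
    (h : ∀ k, ((e, k), true) ∉ events s w) (hk : ((e, k), false) ∈ events s w) :
    k < s.count e := by
  by_contra! hle
  exact h _ (true_mem_events hk hle)

lemma run_count_le {s : Config} {w : ExtExpr n} {e : Sym2 ℕ}
    (h : ∀ k, ((e, k), true) ∉ events s w) : (run s w).count e ≤ s.count e := by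
  induction w generalizing s with
  | nil => exact le_rfl
  | cons l w ih =>
    cases l with
    | pos i =>
      have h1 : e ≠ s.pair i := by
        rintro rfl
        exact h _ List.mem_cons_self
      refine (ih fun k hk => h k (List.mem_cons_of_mem _ hk)).trans ?_
      simp [cross_count, h1]
    | neg i =>
      refine (ih fun k hk => h k (List.mem_cons_of_mem _ hk)).trans ?_
      rw [uncross_count]
      split_ifs <;> omega

/-! ### The effect of a tile on a path -/

lemma pair_sublist_append {α : Type*} {e f : α} {l m : List α} :
    [e, f].Sublist (l ++ m) ↔ [e, f].Sublist l ∨ (e ∈ l ∧ f ∈ m) ∨ [e, f].Sublist m := by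
  constructor
  · intro h
    obtain ⟨a, b, hab, ha, hb⟩ := List.sublist_append_iff.1 h
    rcases a with _ | ⟨a1, _ | ⟨a2, a⟩⟩
    · simp only [List.nil_append] at hab
      exact Or.inr (Or.inr (hab ▸ hb))
    · simp only [List.cons_append, List.nil_append, List.cons.injEq] at hab
      obtain ⟨rfl, rfl⟩ := hab
      exact Or.inr (Or.inl ⟨List.singleton_sublist.1 ha, List.singleton_sublist.1 hb⟩)
    · simp only [List.cons_append, List.cons.injEq] at hab
      obtain ⟨rfl, rfl, h⟩ := hab
      obtain ⟨rfl, rfl⟩ := List.append_eq_nil_iff.1 h.symm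
      exact Or.inl ha
  · rintro (h | ⟨h1, h2⟩ | h)
    · exact h.trans (List.sublist_append_left _ _)
    · exact (List.singleton_sublist.2 h1).append (List.singleton_sublist.2 h2)
    · exact h.trans (List.sublist_append_right _ _)

/-- For each pair of strands, all its horizontal letters come before all its vertical letters. -/
def PosBeforeNeg (l : List Event) : Prop :=
  l.Pairwise fun e f => e.1.1 = f.1.1 → e.2 = false → f.2 = true → False

/-- The path `p = l ++ r`, read from the state `s`, consists of the left edges `l` and the top edges
`r` of a tile with bottom and right edges `q`. At the top-left corner, `l` ends with the letter `i`
and `r` starts with the letter `j`. All the names on `p` remain on `q`, and gluing the tile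
costs one braid move, which is applied at this corner. -/
structure IsHinge (s : Config) (p q : ExtExpr n) (i j : ℕ) (l r : ExtExpr n) : Prop where
  eq_append : p = l ++ r
  run_eq : run s q = run s p
  left_mem : ((run s l).name i, false) ∈ events s l
  right_mem : ((run s l).name j, true) ∈ events (run s l) r
  left_neg : ∀ e ∈ events s l, e.2 = false
  right_pos : ∀ e ∈ events (run s l) r, e.2 = true
  pair_ne : ∀ e ∈ events s l, ∀ f ∈ events (run s l) r, e.1.1 ≠ f.1.1
  subset : events s p ⊆ events s q
  labels : ∀ (a b : NExpr n) (y : ExtExpr n) (κ : Cost), crossWord init a = s →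
    VertexWords a (p ++ y) b κ → VertexWords a (q ++ y) b (κ + (moveVector (run s l) i j, 1))

lemma isHinge_typeI (B : Config) {i j : Fin (n - 1)} (h : Adjacent i j) :
    IsHinge (B.cross i) [.neg i, .pos j] [.pos j, .pos i, .neg j, .neg i] i j [.neg i]
      [.pos j] := by
  have hn := neighbour_of_adjacent h
  have hr : run (B.cross i) [ExtLetter.pos j, .pos i, .neg j, .neg i] = B.cross j := by
    simp [run, cross_braid B hn]
  refine ⟨rfl, ?_, ?_, ?_, ?_, ?_, ?_, ?_, ?_⟩
  · rw [hr]; simp [run]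
  · simp [run, events]
  · simp [run, events]
  · simp [events]
  · simp [events]
  · simp [events, run, name, pair_ne hn.ne]
  · simp [events, cross_braid B hn, cross_cross_name B hn, cross_cross_name B hn.symm]
  · rintro a b y κ ha ⟨b0, κ1, ν, h1, ⟨c, κ2, ν', h2, h3, rfl⟩, rfl⟩
    have hb : crossWord init b0 = B := h1.crossWord_eq_of_cross ha
    have key := ((h1.append [j, i]).trans (by simpa using Derives.relI b0 h)).trans
      (show Derives (b0 ++ [j, i, j]) (c ++ [i, j]) κ2 by simpa using h2.append [i, j])
    rw [hb] at key
    refine ⟨a ++ [j], 0, _, .refl _, ⟨a ++ [j, i], 0, _, by simpa using Derives.refl (a ++ [j, i]),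
      ⟨c ++ [i], _, _, by simpa using key, ⟨c, 0, _, .refl _, h3, rfl⟩, rfl⟩, rfl⟩, ?_⟩
    simp only [run, uncross_cross]
    abel

lemma isHinge_typeIprime (B : Config) {i j : Fin (n - 1)} (h : Adjacent i j) :
    IsHinge (B.cross i) [.neg i, .pos j, .pos i] [.pos j, .pos i, .neg j] i j [.neg i]
      [.pos j, .pos i] := by
  have hn := neighbour_of_adjacent h
  refine ⟨rfl, ?_, ?_, ?_, ?_, ?_, ?_, ?_, ?_⟩
  · simp [run, cross_braid B hn]
  · simp [run, events]
  · simp [run, events]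
  · simp [events]
  · simp [events]
  · simp [events, run, name, pair_ne hn.ne, (cross_pair_ne_right B hn.symm).symm]
  · simp [events, cross_braid B hn, cross_cross_name B hn, cross_cross_name B hn.symm,
      cross_name_comm B hn]
  · rintro a b y κ ha ⟨b0, κ1, ν, h1, ⟨c, κ2, ν', h2, ⟨d, κ3, ν'', h3, h4, rfl⟩, rfl⟩, rfl⟩
    have hb : crossWord init b0 = B := h1.crossWord_eq_of_cross ha
    have key := (((h1.append [j, i]).trans (by simpa using Derives.relI b0 h)).trans
      (show Derives (b0 ++ [j, i, j]) (c ++ [i, j]) κ2 by simpa using h2.append [i, j])).trans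
      (show Derives (c ++ [i, j]) (d ++ [j]) κ3 by simpa using h3.append [j])
    rw [hb] at key
    refine ⟨a ++ [j], 0, _, .refl _, ⟨a ++ [j, i], 0, _, by simpa using Derives.refl (a ++ [j, i]),
      ⟨d, _, _, by simpa using key, h4, rfl⟩, rfl⟩, ?_⟩
    simp only [run, uncross_cross]
    abel

lemma isHinge_typeIsecond (B : Config) {i j : Fin (n - 1)} (h : Adjacent i j) :
    IsHinge ((B.cross i).cross j) [.neg j, .neg i, .pos j] [.pos i, .neg j, .neg i] i j
      [.neg j, .neg i] [.pos j] := by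
  have hn := neighbour_of_adjacent h
  refine ⟨rfl, ?_, ?_, ?_, ?_, ?_, ?_, ?_, ?_⟩
  · simp [run, cross_braid B hn]
  · simp [run, events]
  · simp [run, events]
  · simp [events]
  · simp [events]
  · simp [events, run, name, pair_ne hn.ne, cross_pair_ne_right B hn]
  · simp [events, cross_braid B hn, cross_cross_name B hn, cross_cross_name B hn.symm,
      cross_name_comm B hn]
  · rintro a b y κ ha ⟨a1, κ1, ν, h1, ⟨b0, κ2, ν', h2, ⟨c, κ3, ν'', h3, h4, rfl⟩, rfl⟩, rfl⟩
    have hb : crossWord init b0 = B :=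
      h2.crossWord_eq_of_cross (h1.crossWord_eq_of_cross ha)
    have key := (((h1.append [i]).trans
      (show Derives (a1 ++ [j] ++ [i]) (b0 ++ [i, j, i]) κ2 by
        simpa using h2.append [j, i])).trans
      (Derives.relI b0 h)).trans
      (show Derives (b0 ++ [j, i, j]) (c ++ [i, j]) κ3 by simpa using h3.append [i, j])
    rw [hb] at key
    refine ⟨a ++ [i], 0, _, .refl _, ⟨c ++ [i], _, _, by simpa using key,
      ⟨c, 0, _, .refl _, h4, rfl⟩, rfl⟩, ?_⟩
    simp only [run, uncross_cross]
    abel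

lemma isHinge_typeII (B : Config) {i j : Fin (n - 1)} (h : Far i j) :
    IsHinge (B.cross i) [.neg i, .pos j] [.pos j, .neg i] i j [.neg i] [.pos j] := by
  have hn := distant_of_far h
  refine ⟨rfl, ?_, ?_, ?_, ?_, ?_, ?_, ?_, ?_⟩
  · simp [run, cross_comm B hn]
  · simp [run, events]
  · simp [run, events]
  · simp [events]
  · simp [events]
  · simp [events, run, name, pair_ne hn.ne]
  · simp [events, cross_comm B hn, cross_name_distant B hn, cross_name_distant B hn.symm]
  · rintro a b y κ ha ⟨b0, κ1, ν, h1, ⟨c, κ2, ν', h2, h3, rfl⟩, rfl⟩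
    have hb : crossWord init b0 = B := h1.crossWord_eq_of_cross ha
    have key := ((h1.append [j]).trans (by simpa using Derives.relII b0 h)).trans
      (show Derives (b0 ++ [j, i]) (c ++ [i]) κ2 by simpa using h2.append [i])
    rw [hb] at key
    refine ⟨a ++ [j], 0, _, .refl _, ⟨c, _, _, by simpa using key, h3, rfl⟩, ?_⟩
    simp only [run, uncross_cross]
    abel

lemma exists_isHinge {t : TileType} {p q : ExtExpr n} (h : Tile t p q) (ht : t ≠ .III)
    (s : Config) : ∃ i j l r, IsHinge s p q i j l r := by
  cases h with
  | typeI i j h =>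
    rw [← cross_uncross s i]
    exact ⟨_, _, _, _, isHinge_typeI _ h⟩
  | typeIprime i j h =>
    rw [← cross_uncross s i]
    exact ⟨_, _, _, _, isHinge_typeIprime _ h⟩
  | typeIsecond i j h =>
    rw [← cross_uncross s j, ← cross_uncross (s.uncross j) i]
    exact ⟨_, _, _, _, isHinge_typeIsecond _ h⟩
  | typeII i j h =>
    rw [← cross_uncross s i]
    exact ⟨_, _, _, _, isHinge_typeII _ h⟩
  | typeIII => exact absurd rfl ht

/-! ### Moves without cancellation -/

lemma PosBeforeNeg.of_pos {l : List Event} (h : ∀ e ∈ l, e.2 = true) : PosBeforeNeg l :=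
  List.Pairwise.imp_of_mem (R := fun _ _ => True)
    (fun he _ _ _ h1 _ => by simp [h _ he] at h1) (List.pairwise_of_forall (by simp))

lemma PosBeforeNeg.of_neg {l : List Event} (h : ∀ e ∈ l, e.2 = false) : PosBeforeNeg l :=
  List.Pairwise.imp_of_mem (R := fun _ _ => True)
    (fun _ hf _ _ _ h2 => by simp [h _ hf] at h2) (List.pairwise_of_forall (by simp))

/-- Replacing `q` by `p` in a path, which removes a tile, preserves `PosBeforeNeg`: it suffices that
all the letters of `p` occur in `q`. -/
lemma PosBeforeNeg.of_subset {a p q c : List Event} (hpq : p ⊆ q) (hp : PosBeforeNeg p)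
    (h : PosBeforeNeg (a ++ (q ++ c))) : PosBeforeNeg (a ++ (p ++ c)) := by
  unfold PosBeforeNeg at *
  simp only [List.pairwise_append, List.mem_append] at h ⊢
  obtain ⟨ha, ⟨-, hc, hqc⟩, haq⟩ := h
  exact ⟨ha, ⟨hp, hc, fun e he => hqc e (hpq he)⟩,
    fun e he f hf => haq e he f (hf.imp_left fun h => hpq h)⟩

/-- Gluing a tile preserves the existence of a letter `X` before a letter `Z` as in `Separated`. -/
lemma pair_sublist_replace {a p q c : List Event} {X Z : Name} (hpq : p ⊆ q)
    (hp : ¬ [(X, true), (Z, false)].Sublist p)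
    (h : [(X, true), (Z, false)].Sublist (a ++ (p ++ c))) :
    [(X, true), (Z, false)].Sublist (a ++ (q ++ c)) := by
  simp only [pair_sublist_append, List.mem_append] at h ⊢
  rcases h with h | ⟨h1, h2 | h2⟩ | h | ⟨h1, h2⟩ | h
  · exact .inl h
  · exact .inr (.inl ⟨h1, .inl (hpq h2)⟩)
  · exact .inr (.inl ⟨h1, .inr h2⟩)
  · exact absurd h hp
  · exact .inr (.inr (.inr (.inl ⟨hpq h1, h2⟩)))
  · exact .inr (.inr (.inr (.inr h)))

namespace IsHinge

variable {s : Config} {p q l r : ExtExpr n} {i j : ℕ}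

lemma posBeforeNeg (h : IsHinge s p q i j l r) : PosBeforeNeg (events s p) := by
  rw [h.eq_append, events_append]
  exact List.pairwise_append.2 ⟨PosBeforeNeg.of_neg h.left_neg, PosBeforeNeg.of_pos h.right_pos,
    fun e he f hf hef => absurd hef (h.pair_ne e he f hf)⟩

lemma not_sublist (h : IsHinge s p q i j l r) (X Z : Name) :
    ¬ [(X, true), (Z, false)].Sublist (events s p) := by
  rw [h.eq_append, events_append, pair_sublist_append]
  rintro (hl | ⟨hl, -⟩ | hr)
  · simpa using h.left_neg _ (hl.subset (List.mem_cons_self))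
  · simpa using h.left_neg _ hl
  · simpa using h.right_pos _ (hr.subset (by simp : (Z, false) ∈ [(X, true), (Z, false)]))

end IsHinge

/-- Provided the counts at the ends of the path allow it, there is a horizontal letter `X` before a
vertical letter `Z`. -/
def Separated (s : Config) (w : ExtExpr n) (X Z : Name) : Prop :=
  s.count X.1 ≤ X.2 → (run s w).count Z.1 ≤ Z.2 →
    [(X, true), (Z, false)].Sublist (events s w)

lemma separated_of_hinge {s : Config} {l r : ExtExpr n} {X Z : Name}
    (hX : (X, false) ∈ events s l) (hZ : (Z, true) ∈ events (run s l) r) :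
    Separated s (l ++ r) X Z := by
  intro h1 h2
  rw [run_append] at h2
  rw [events_append, pair_sublist_append]
  exact .inr (.inl ⟨true_mem_events hX h1, false_mem_events hZ h2⟩)

/-- At a corner with `Z` on its left and `X` on its top, `PosBeforeNeg` makes the counts of the two
pairs monotone on the relevant parts of the path, so no other letter is named `X` before the corner
or `Z` after it. -/
lemma not_separated_of_hinge {s : Config} {l r : ExtExpr n} {i j : ℕ}
    (hs : PosBeforeNeg (events s (l ++ r)))
    (hX : ((run s l).name i, false) ∈ events s l)
    (hZ : ((run s l).name j, true) ∈ events (run s l) r) :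
    ¬ Separated s (l ++ r) ((run s l).name j) ((run s l).name i) := by
  intro h
  unfold Separated at h
  rw [events_append] at hs
  have hlr := (List.pairwise_append.1 hs).2.2
  have hl : ∀ k, (((run s l).pair j, k), false) ∉ events s l :=
    fun k hk => hlr _ hk _ hZ rfl rfl rfl
  have hr : ∀ k, (((run s l).pair i, k), true) ∉ events (run s l) r :=
    fun k hk => hlr _ hX _ hk rfl rfl rfl
  rw [run_append, events_append, pair_sublist_append] at h
  have hjl : ((run s l).name j, true) ∉ events s l := fun hm => (lt_run_count hl hm).false
  have hir : ((run s l).name i, false) ∉ events (run s l) r := fun hm => (lt_count hr hm).false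
  rcases h (count_le_run hl) (run_count_le hr) with h | ⟨h, -⟩ | h
  · exact hjl (h.subset List.mem_cons_self)
  · exact hjl h
  · exact hir (h.subset (by simp))

/-- The braid move between the words that start with `i` and with `j` in a state. -/
abbrev Move : Type := Config × ℕ × ℕ

namespace Move

/-- The name of the last left edge of the tile. -/
def left (t : Move) : Name := t.1.name t.2.1

/-- The name of the first top edge of the tile. -/
def top (t : Move) : Name := t.1.name t.2.2

def label (t : Move) : Label := moveLabel t.1 t.2.1 t.2.2

def sign (t : Move) : ℤ := moveSign t.1 t.2.1 t.2.2

noncomputable def vector (t : Move) : Label →₀ ℤ := moveVector t.1 t.2.1 t.2.2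

end Move

/-- The names of the outer two of the letters permuted by a move. They are the names of the left and
top edges at the corner of the tile, in an order that depends on the sign of the move. -/
def Label.outer : Label → Name × Name
  | .hex p q r α _ γ => ((s(p, q), α), (s(q, r), γ))
  | .square X Z => (X, Z)

lemma Move.outer_label (t : Move) :
    (t.sign = 1 ∧ t.label.outer = (t.left, t.top)) ∨
      (t.sign = -1 ∧ t.label.outer = (t.top, t.left)) := by
  obtain ⟨s, i, j⟩ := t
  simp only [Move.sign, Move.label, Move.left, Move.top, moveSign, moveLabel]
  split_ifs with h1 h2 h3
  · subst h1
    exact .inl ⟨rfl, rfl⟩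
  · subst h2
    exact .inr ⟨rfl, rfl⟩
  · exact .inl ⟨rfl, rfl⟩
  · exact .inr ⟨rfl, rfl⟩

/-- Moves with the same label and opposite signs have the left and top names exchanged. -/
lemma Move.swap_of_sign_ne {t t' : Move} (hl : t.label = t'.label) (hs : t.sign ≠ t'.sign) :
    t.left = t'.top ∧ t.top = t'.left := by
  have h := t.outer_label
  have h' := t'.outer_label
  rw [← hl] at h'
  rcases h with ⟨h1, h2⟩ | ⟨h1, h2⟩ <;> rcases h' with ⟨h3, h4⟩ | ⟨h3, h4⟩
  · exact absurd (h1.trans h3.symm) hs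
  · exact Prod.ext_iff.1 (h2.symm.trans h4)
  · exact (Prod.ext_iff.1 (h2.symm.trans h4)).symm
  · exact absurd (h1.trans h3.symm) hs

lemma Separated.replace {s : Config} {x p q y l r : ExtExpr n} {i j : ℕ} {X Z : Name}
    (h : IsHinge (run s x) p q i j l r) (hs : Separated s (x ++ p ++ y) X Z) :
    Separated s (x ++ q ++ y) X Z := by
  have hr := h.run_eq
  unfold Separated at hs ⊢
  simp only [List.append_assoc, run_append, events_append, hr] at hs ⊢
  exact fun h1 h2 => pair_sublist_replace h.subset (h.not_sublist X Z) (hs h1 h2)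

/-- The moves of the tiles of a diagram without digons. They make up a derivation with as many steps
as there are tiles, and the signed labels of any two of them do not cancel. -/
theorem exists_moves {u v : NExpr n} {w : ExtExpr n}
    (D : CompactedDiagram (u.bar ++ v.toExt) w) (hD : TileType.III ∉ D.tiles)
    (hw : PosBeforeNeg (events (crossWord init u) w)) :
    ∃ ts : List Move, ts.length = D.tiles.length ∧
      VertexWords u w v ((ts.map Move.vector).sum, ts.length) ∧
      (∀ t ∈ ts, Separated (crossWord init u) w t.left t.top) ∧
      ∀ t ∈ ts, ∀ t' ∈ ts, t.label = t'.label → t.sign = t'.sign := by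
  induction D with
  | start =>
    refine ⟨[], rfl, ?_, by simp, by simp⟩
    rw [vertexWords_append]
    exact ⟨[], 0, 0, vertexWords_bar_self [] u, vertexWords_toExt_self [] v, rfl⟩
  | addTile D x p q y t ht hw1 hw2 ih =>
    subst hw1 hw2
    simp only [CompactedDiagram.tiles, List.mem_cons, not_or] at hD
    obtain ⟨i, j, l, r, h⟩ := exists_isHinge ht (Ne.symm hD.1) (run (crossWord init u) x)
    -- `PosBeforeNeg` is known for the last path and goes back to the earlier ones.
    have hsort : PosBeforeNeg (events (crossWord init u) (x ++ p ++ y)) := by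
      rw [List.append_assoc, events_append, events_append] at hw ⊢
      rw [h.run_eq] at hw
      exact PosBeforeNeg.of_subset h.subset h.posBeforeNeg hw
    obtain ⟨ts, hlen, hlab, hsep, hsign⟩ := ih hD.2 hsort
    set s := crossWord init u with hs
    have heq : x ++ p ++ y = (x ++ l) ++ (r ++ y) := by
      rw [h.eq_append]; simp
    have hl : ((run s (x ++ l)).name i, false) ∈ events s (x ++ l) := by
      rw [events_append, run_append]
      exact List.mem_append_right _ h.left_mem
    have hr : ((run s (x ++ l)).name j, true) ∈ events (run s (x ++ l)) (r ++ y) := by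
      rw [events_append, run_append]
      exact List.mem_append_left _ h.right_mem
    refine ⟨(run s (x ++ l), i, j) :: ts, by simp [CompactedDiagram.tiles, hlen], ?_, ?_, ?_⟩
    · rw [List.append_assoc, vertexWords_append] at hlab ⊢
      obtain ⟨c, μ, ν, h1, h2, h3⟩ := hlab
      refine ⟨c, μ, _, h1, h.labels c v y ν h1.run_eq.symm h2, ?_⟩
      rw [← add_assoc, ← h3, ← run_append, List.map_cons, List.sum_cons, List.length_cons,
        add_comm (Move.vector _)]
      rfl
    · intro t ht
      rcases List.mem_cons.1 ht with rfl | ht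
      · refine Separated.replace h ?_
        rw [heq]
        exact separated_of_hinge hl hr
      · exact Separated.replace h (hsep t ht)
    · have key : ∀ t ∈ ts, t.label = Move.label (run s (x ++ l), i, j) →
          t.sign = Move.sign (run s (x ++ l), i, j) := by
        intro t ht hlabel
        by_contra hne
        obtain ⟨h1, h2⟩ := Move.swap_of_sign_ne hlabel hne
        have h3 := hsep t ht
        rw [h1, h2, heq] at h3
        rw [heq] at hsort
        exact not_separated_of_hinge hsort hl hr h3
      intro t ht t' ht' he
      rcases List.mem_cons.1 ht with rfl | ht <;> rcases List.mem_cons.1 ht' with rfl | ht'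
      · rfl
      · exact (key t' ht' he.symm).symm
      · exact key t ht he
      · exact hsign t ht t' ht' he

lemma posBeforeNeg_toExt_append_bar (s : Config) (v u : NExpr n) :
    PosBeforeNeg (events s (v.toExt ++ u.bar)) := by
  have hv : ∀ (v : NExpr n) (s : Config), ∀ e ∈ events s v.toExt, e.2 = true := by
    intro v
    induction v with
    | nil => simp [NExpr.toExt, events]
    | cons i v ih =>
      intro s e he
      rcases List.mem_cons.1 he with rfl | he
      · rfl
      · exact ih _ e he
  have hu : ∀ (u : NExpr n) (s : Config), ∀ e ∈ events s u.bar, e.2 = false := by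
    intro u
    induction u with
    | nil => simp [NExpr.bar, events]
    | cons i u ih =>
      intro s e he
      have hb : NExpr.bar (i :: u) = NExpr.bar u ++ [.neg i] := by simp [NExpr.bar]
      rw [hb, events_append] at he
      rcases List.mem_append.1 he with he | he
      · exact ih _ e he
      · simp only [events, List.mem_singleton] at he
        rw [he]
  rw [events_append]
  exact List.pairwise_append.2 ⟨PosBeforeNeg.of_pos (hv v s), PosBeforeNeg.of_neg (hu u _),
    fun e _ f hf _ _ h => by simp [hu _ _ f hf] at h⟩

/-- The signs of moves that do not cancel extend to a functional that counts these moves. -/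
lemma exists_functional {ts : List Move}
    (h : ∀ t ∈ ts, ∀ t' ∈ ts, t.label = t'.label → t.sign = t'.sign) :
    ∃ f : Label → ℤ, (∀ a, |f a| ≤ 1) ∧
      Finsupp.linearCombination ℤ f (ts.map Move.vector).sum = ts.length := by
  classical
  let f : Label → ℤ := fun a => if ha : ∃ t ∈ ts, t.label = a then ha.choose.sign else 0
  have hf : ∀ t ∈ ts, f t.label = t.sign := by
    intro t ht
    have ha : ∃ t' ∈ ts, t'.label = t.label := ⟨t, ht, rfl⟩
    simp only [f, dif_pos ha]
    exact h _ ha.choose_spec.1 _ ht ha.choose_spec.2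
  refine ⟨f, fun a => ?_, ?_⟩
  · simp only [f]
    split_ifs with ha
    · exact (abs_moveSign _ _ _).le
    · simp
  · rw [map_list_sum, List.map_map, List.map_congr_left (g := fun _ => (1 : ℤ))]
    · simp
    · intro t ht
      have : Finsupp.linearCombination ℤ f t.vector = t.sign * f t.label := by
        simp [Move.vector, moveVector, Move.sign, Move.label]
      rw [Function.comp_apply, this, hf t ht, ← abs_mul_abs_self]
      simp [Move.sign, abs_moveSign]

end BraidDistance

open BraidDistance

theorem propositionP {n : ℕ} (u v : NExpr n) (D : CompactedReversingDiagram u v)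
    (hD : D.NoDigon) : D.IsOptimal := by
  obtain ⟨ts, hlen, hlab, -, hsign⟩ :=
    exists_moves D.diagram hD (posBeforeNeg_toExt_append_bar _ _ _)
  obtain ⟨c, μ, ν, h1, h2, h3⟩ := vertexWords_append.1 hlab
  have hder := ((vertexWords_toExt h1).trans (vertexWords_bar h2))
  rw [← h3] at hder
  have hnum : D.numTiles = ts.length := by
    rw [hlen, CompactedReversingDiagram.numTiles, List.filter_eq_self.2]
    intro t ht
    have : t ≠ TileType.III := fun h => hD (h ▸ ht)
    simpa using this
  unfold CompactedReversingDiagram.IsOptimal combDist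
  rw [hnum]
  refine le_antisymm (le_iInf₂ fun N hN => ?_) (iInf₂_le ts.length hder.1)
  obtain ⟨x, hx, hle⟩ := BraidDerivation.exists_vector hN Config.init
  obtain ⟨f, hf, hfx⟩ := exists_functional hsign
  have hxe : x = (ts.map Move.vector).sum := boundaryMap_injective (hx.trans hder.2.symm)
  have := hle f hf
  rw [hxe, hfx] at this
  exact_mod_cast this
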